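/- A pseudo-BCK algebra is a structure $(A,\le,\to,\rightsquigarrow,1)$, where $\le$ is a binary relation on $A$, $\to$ and $\rightsquigarrow$ are binary operations on $A$ and $1\in A$, such that for all $x,y,z\in A$: (1) $x\to y\le (y\to z)\rightsquigarrow(x\to z)$ and $x\rightsquigarrow y\le (y\rightsquigarrow z)\to(x\rightsquigarrow z)$; (2) $x\le (x\to y)\rightsquigarrow y$ and $x\le (x\rightsquigarrow y)\to y$; (3) $x\le x$; (4) $x\le 1$; (5) $x\le y$ and $y\le x$ imply $x=y$; (6) $x\le y$ iff $x\to y=1$ iff $x\rightsquigarrow y=1$. It is bounded if it has an element $0$ with $0\le x$ for all $x\in A$. Let $A$ be a bounded pseudo-BCK algebra. A Bosbach state on $A$ is a function $s:A\to[0,1]$ with $s(0)=0$, $s(1)=1$, $s(x)+s(x\to y)=s(y)+s(y\to x)$ and $s(x)+s(x\rightsquigarrow y)=s(y)+s(y\rightsquigarrow x)$ for all $x,y\in A$. A state-morphism on $A$ is a function $m:A\to[0,1]$ with $m(0)=0$ and $m(x\to y)=m(x\rightsquigarrow y)=\min\{1-m(x)+m(y),1\}$ for all $x,y\in A$. Let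 $\mathcal{BS}(A)$ be the set of Bosbach states on $A$ and $\mathcal{W}$ the set of state-morphisms on $A$. For a finite subset $A'=\{a_1,\dots,a_n\}$ of $A$ (with $a_1,\dots,a_n$ distinct), a map $\beta:A'\to[0,1]$ is coherent over $A'$ (with respect to $\mathcal W$) if for all $\sigma_1,\dots,\sigma_n\in\mathbb{R}$ there is $V\in\mathcal{W}$ such that $\sum_{i=1}^n\sigma_i(\beta(a_i)-V(a_i))\ge 0$. A de Finetti map on $A$ is a function $\beta:A\to[0,1]$ whose restriction to every finite subset of $A$ is coherent over that subset; let $\mathcal{F}_{\mathcal W}$ be the set of all de Finetti maps on $A$. **Theorem.** Let $A$ be a bounded pseudo-BCK algebra with $\mathcal{W}\neq\emptyset$. Then $$\mathcal{F}_{\mathcal{W}}=\mathcal{BS}(A).$$ -/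

import Mathlib

/-- The two implication operations of a pseudo-BCK algebra. -/
class PseudoBCKArrows (A : Type*) where
  /-- the operation written `→` in the literature -/
  imp : A → A → A
  /-- the operation written `⇝` in the literature -/
  imp' : A → A → A

infixr:60 " ⇀ " => PseudoBCKArrows.imp
infixr:60 " ⇝ " => PseudoBCKArrows.imp'

/-- A pseudo-BCK algebra `(A, ≤, →, ⇝, 1)`. -/
class PseudoBCKAlgebra (A : Type*) extends LE A, PseudoBCKArrows A, One A where
  imp_le : ∀ x y z : A, (x ⇀ y) ≤ ((y ⇀ z) ⇝ (x ⇀ z))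
  imp'_le : ∀ x y z : A, (x ⇝ y) ≤ ((y ⇝ z) ⇀ (x ⇝ z))
  le_imp_imp' : ∀ x y : A, x ≤ ((x ⇀ y) ⇝ y)
  le_imp'_imp : ∀ x y : A, x ≤ ((x ⇝ y) ⇀ y)
  le_refl' : ∀ x : A, x ≤ x
  le_one' : ∀ x : A, x ≤ 1
  le_antisymm' : ∀ x y : A, x ≤ y → y ≤ x → x = y
  le_iff_imp : ∀ x y : A, x ≤ y ↔ (x ⇀ y) = 1
  le_iff_imp' : ∀ x y : A, x ≤ y ↔ (x ⇝ y) = 1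

/-- A bounded pseudo-BCK algebra `(A, ≤, →, ⇝, 0, 1)`: a pseudo-BCK algebra with a least
element `0`. -/
class BoundedPseudoBCKAlgebra (A : Type*) extends PseudoBCKAlgebra A, Zero A where
  zero_le' : ∀ x : A, 0 ≤ x

/-- The Łukasiewicz implication `min {1 - x + y, 1}` on the real unit interval. -/
noncomputable def lukasiewiczImp (x y : unitInterval) : unitInterval :=
  ⟨min (1 - (x : ℝ) + (y : ℝ)) 1,
    le_min (by linarith [x.2.2, y.2.1]) zero_le_one, min_le_right _ _⟩

/-- A Bosbach state on a bounded pseudo-BCK algebra. -/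
structure IsBosbachState {A : Type*} [BoundedPseudoBCKAlgebra A] (s : A → unitInterval) :
    Prop where
  add_imp : ∀ x y : A, (s x : ℝ) + (s (x ⇀ y) : ℝ) = (s y : ℝ) + (s (y ⇀ x) : ℝ)
  add_imp' : ∀ x y : A, (s x : ℝ) + (s (x ⇝ y) : ℝ) = (s y : ℝ) + (s (y ⇝ x) : ℝ)
  map_zero : s 0 = 0
  map_one : s 1 = 1

/-- A state-morphism on a bounded pseudo-BCK algebra. -/
structure IsStateMorphism {A : Type*} [BoundedPseudoBCKAlgebra A] (m : A → unitInterval) :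
    Prop where
  map_zero : m 0 = 0
  map_imp : ∀ x y : A, m (x ⇀ y) = lukasiewiczImp (m x) (m y)
  map_imp' : ∀ x y : A, m (x ⇝ y) = lukasiewiczImp (m x) (m y)

/-- The set of all Bosbach states on `A`. -/
def bosbachStates (A : Type*) [BoundedPseudoBCKAlgebra A] : Set (A → unitInterval) :=
  {s | IsBosbachState s}

/-- The set of all state-morphisms on `A`. -/
def stateMorphisms (A : Type*) [BoundedPseudoBCKAlgebra A] : Set (A → unitInterval) :=
  {m | IsStateMorphism m}

/-- A map `β : A' → [0,1]` on a finite subset `A'` of `A` is coherent over `A'` with respect to a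
set `W` of functions `A → [0,1]`. -/
def IsCoherent {A : Type*} (W : Set (A → unitInterval)) (A' : Finset A)
    (β : A' → unitInterval) : Prop :=
  ∀ σ : A' → ℝ, ∃ V ∈ W, 0 ≤ ∑ a : A', σ a * ((β a : ℝ) - (V (a : A) : ℝ))

/-- The set of all de Finetti maps on `A` with respect to `W`: the maps `β : A → [0,1]` whose
restriction to every finite subset of `A` is coherent. -/
def deFinettiMaps {A : Type*} (W : Set (A → unitInterval)) : Set (A → unitInterval) :=
  {β | ∀ A' : Finset A, IsCoherent W A' (fun a => β (a : A))}

/-! A de Finetti map inherits every affine relation valid throughout `W`, as coherence for `σ` and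
`-σ` shows; the Bosbach equations are such relations. Conversely, a linear functional on the compact
set of Bosbach states attains its minimum at an extreme point, so it suffices that extreme Bosbach
states are state-morphisms.

For a Bosbach state `s` and `a`, let `r x = sup_n s (aⁿ → x)`. Then `r` satisfies the Bosbach
equations, so `1 - s = (1 - r) + (r - s)` splits `s` into normalized Bosbach states; extremality
makes `1 - r` proportional to `1 - s`. For `a = x ⇀ y`, `r a = 1`, while prelinearity gives `r (y ⇀
x) = s (y ⇀ x)`. Hence `s (x ⇀ y) = 1` or `s (y ⇀ x) = 1`, which forces the Łukasiewicz formula. -/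

open Filter Topology

/-! ### Arithmetic of pseudo-BCK algebras -/

namespace PseudoBCKAlgebra

variable {A : Type*} [PseudoBCKAlgebra A] {x y z a : A}

theorem one_le (h : (1 : A) ≤ x) : x = 1 := le_antisymm' _ _ (le_one' x) h

theorem trans (h₁ : x ≤ y) (h₂ : y ≤ z) : x ≤ z := by
  have h := imp_le x y z
  rw [(le_iff_imp x y).1 h₁, (le_iff_imp y z).1 h₂] at h
  exact (le_iff_imp x z).2 (one_le ((le_iff_imp' _ _).2 (one_le h)))

theorem imp_anti (h : x ≤ y) (z : A) : (y ⇀ z) ≤ (x ⇀ z) := by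
  have h' := imp_le x y z
  rw [(le_iff_imp x y).1 h] at h'
  exact (le_iff_imp' _ _).2 (one_le h')

theorem imp'_anti (h : x ≤ y) (z : A) : (y ⇝ z) ≤ (x ⇝ z) := by
  have h' := imp'_le x y z
  rw [(le_iff_imp' x y).1 h] at h'
  exact (le_iff_imp _ _).2 (one_le h')

theorem le_imp'_of_le_imp (h : x ≤ (y ⇀ z)) : y ≤ (x ⇝ z) :=
  trans (le_imp_imp' y z) (imp'_anti h z)

theorem le_imp_of_le_imp' (h : x ≤ (y ⇝ z)) : y ≤ (x ⇀ z) :=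
  trans (le_imp'_imp y z) (imp_anti h z)

theorem imp_self (x : A) : (x ⇀ x) = 1 := (le_iff_imp x x).1 (le_refl' x)

theorem imp'_self (x : A) : (x ⇝ x) = 1 := (le_iff_imp' x x).1 (le_refl' x)

theorem le_imp (x y : A) : y ≤ (x ⇀ y) :=
  le_imp_of_le_imp' (by rw [imp'_self]; exact le_one' x)

theorem le_imp' (x y : A) : y ≤ (x ⇝ y) :=
  le_imp'_of_le_imp (by rw [imp_self]; exact le_one' x)

theorem imp_le_imp_imp (x y z : A) : (x ⇀ y) ≤ ((z ⇀ x) ⇀ (z ⇀ y)) :=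
  le_imp_of_le_imp' (imp_le z x y)

theorem imp'_le_imp'_imp' (x y z : A) : (x ⇝ y) ≤ ((z ⇝ x) ⇝ (z ⇝ y)) :=
  le_imp'_of_le_imp (imp'_le z x y)

theorem imp_imp'_comm (x y z : A) : (x ⇀ (y ⇝ z)) = (y ⇝ (x ⇀ z)) :=
  le_antisymm' _ _
    (le_imp'_of_le_imp (trans (le_imp'_imp y z) (imp_le_imp_imp _ _ x)))
    (le_imp_of_le_imp' (trans (le_imp_imp' x z) (imp'_le_imp'_imp' _ _ y)))

theorem imp'_mono_right (h : x ≤ y) (z : A) : (z ⇝ x) ≤ (z ⇝ y) := by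
  have h' := imp'_le_imp'_imp' x y z
  rw [(le_iff_imp' x y).1 h] at h'
  exact (le_iff_imp' _ _).2 (one_le h')

theorem le_iterate_imp' (a x : A) (n : ℕ) : x ≤ (a ⇝ ·)^[n] x := by
  induction n with
  | zero => exact le_refl' x
  | succ n ih =>
    rw [Function.iterate_succ_apply']
    exact trans ih (le_imp' _ _)

theorem iterate_imp'_mono (a : A) (h : x ≤ y) (n : ℕ) :
    (a ⇝ ·)^[n] x ≤ (a ⇝ ·)^[n] y := by
  induction n with
  | zero => exact h
  | succ n ih =>
    simp only [Function.iterate_succ_apply']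
    exact imp'_mono_right ih a

theorem iterate_imp'_imp (a x y : A) (n : ℕ) :
    (a ⇝ ·)^[n] (x ⇀ y) = (x ⇀ (a ⇝ ·)^[n] y) := by
  induction n with
  | zero => rfl
  | succ n ih => simp only [Function.iterate_succ_apply', ih, imp_imp'_comm]

theorem imp_le_iterate_imp (a x y : A) (n : ℕ) :
    (x ⇀ y) ≤ ((a ⇀ ·)^[n] x ⇀ (a ⇀ ·)^[n] y) := by
  induction n with
  | zero => exact le_refl' _
  | succ n ih =>
    simp only [Function.iterate_succ_apply']
    exact trans ih (imp_le_imp_imp _ _ a)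

end PseudoBCKAlgebra

open PseudoBCKAlgebra

/-- The bounded pseudo-BCK algebra in which the two implications are interchanged. -/
abbrev BoundedPseudoBCKAlgebra.dual (A : Type*) [BoundedPseudoBCKAlgebra A] :
    BoundedPseudoBCKAlgebra A where
  le x y := x ≤ y
  imp x y := x ⇝ y
  imp' x y := x ⇀ y
  one := 1
  zero := 0
  imp_le := imp'_le
  imp'_le := imp_le
  le_imp_imp' := le_imp'_imp
  le_imp'_imp := le_imp_imp'
  le_refl' := le_refl'
  le_one' := le_one'
  le_antisymm' := le_antisymm'
  le_iff_imp := le_iff_imp'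
  le_iff_imp' := le_iff_imp
  zero_le' := BoundedPseudoBCKAlgebra.zero_le'

/-- Bosbach states, as real-valued functions. -/
structure IsRealBosbachState {A : Type*} [BoundedPseudoBCKAlgebra A] (s : A → ℝ) : Prop where
  nonneg : ∀ x, 0 ≤ s x
  le_one : ∀ x, s x ≤ 1
  add_imp : ∀ x y : A, s x + s (x ⇀ y) = s y + s (y ⇀ x)
  add_imp' : ∀ x y : A, s x + s (x ⇝ y) = s y + s (y ⇝ x)
  map_zero : s 0 = 0
  map_one : s 1 = 1

/-! ### Bosbach states and equality modulo their kernels -/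

namespace IsRealBosbachState

variable {A : Type*} [BoundedPseudoBCKAlgebra A] {s : A → ℝ} {x y z a : A}

theorem dual (hs : IsRealBosbachState s) :
    @IsRealBosbachState A (BoundedPseudoBCKAlgebra.dual A) s :=
  @IsRealBosbachState.mk A (BoundedPseudoBCKAlgebra.dual A) s
    hs.nonneg hs.le_one hs.add_imp' hs.add_imp hs.map_zero hs.map_one

theorem imp_of_ge (hs : IsRealBosbachState s) (h : y ≤ x) : s (x ⇀ y) = 1 - s x + s y := by
  have := hs.add_imp x y
  rw [(le_iff_imp y x).1 h, hs.map_one] at this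
  linarith

theorem imp'_of_ge (hs : IsRealBosbachState s) (h : y ≤ x) : s (x ⇝ y) = 1 - s x + s y :=
  @imp_of_ge A (BoundedPseudoBCKAlgebra.dual A) s x y hs.dual h

theorem mono (hs : IsRealBosbachState s) (h : x ≤ y) : s x ≤ s y := by
  linarith [hs.imp_of_ge h, hs.le_one (y ⇀ x)]

theorem eq_one (hs : IsRealBosbachState s) (h : x ≤ y) (hx : s x = 1) : s y = 1 :=
  _root_.le_antisymm (hs.le_one y) (hx ▸ hs.mono h)

theorem le_of_imp (hs : IsRealBosbachState s) (h : s (x ⇀ y) = 1) : s x ≤ s y := by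
  linarith [hs.add_imp x y, hs.le_one (y ⇀ x)]

theorem join (hs : IsRealBosbachState s) (x y : A) :
    s ((x ⇀ y) ⇝ y) = 1 - s (x ⇀ y) + s y :=
  hs.imp'_of_ge (PseudoBCKAlgebra.le_imp x y)

/-- Put `j = (x ⇀ y) ⇝ y`. Since `x ≤ j`, the opposite join `(x ⇝ y) ⇀ y` lies below `(j ⇝ y) ⇀ y`,
whose value is `s j` because `y ≤ j`. -/
theorem imp_le_imp' (hs : IsRealBosbachState s) (x y : A) : s (x ⇀ y) ≤ s (x ⇝ y) := by
  have h₁ : ((x ⇝ y) ⇀ y) ≤ ((((x ⇀ y) ⇝ y) ⇝ y) ⇀ y) :=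
    imp_anti (imp'_anti (le_imp_imp' x y) y) y
  have h₂ := hs.mono h₁
  rw [hs.imp_of_ge (PseudoBCKAlgebra.le_imp' x y), hs.imp_of_ge (PseudoBCKAlgebra.le_imp' _ y),
    hs.imp'_of_ge (PseudoBCKAlgebra.le_imp' _ y), hs.join] at h₂
  linarith

theorem imp_eq_imp' (hs : IsRealBosbachState s) (x y : A) : s (x ⇀ y) = s (x ⇝ y) :=
  _root_.le_antisymm (hs.imp_le_imp' x y)
    (@imp_le_imp' A (BoundedPseudoBCKAlgebra.dual A) s hs.dual x y)

theorem join_le (hs : IsRealBosbachState s) (hx : x ≤ z) (hy : y ≤ z) :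
    s ((x ⇀ y) ⇝ y) ≤ s z := by
  have h := hs.mono (imp'_anti (imp_anti hx y) y)
  rw [hs.join z y, hs.imp_of_ge hy] at h
  linarith

theorem add_imp_le (hs : IsRealBosbachState s) (x y : A) : s x + s (x ⇀ y) ≤ 1 + s y := by
  linarith [hs.add_imp x y, hs.le_one (y ⇀ x)]

/-- The joins `(x ⇀ y) ⇝ y` and `(y ⇀ x) ⇝ x` agree modulo the kernel of a Bosbach state. -/
theorem join_imp_join (hs : IsRealBosbachState s) (x y : A) :
    s (((x ⇀ y) ⇝ y) ⇀ ((y ⇀ x) ⇝ x)) = 1 := by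
  set v := (y ⇀ x) ⇝ x with hv
  have hyv : y ≤ v := le_imp_imp' y x
  have hxv : x ≤ v := PseudoBCKAlgebra.le_imp' _ x
  -- Joining `v` with `y ≤ v` does not change its value.
  have h : s (((v ⇀ y) ⇝ y) ⇀ v) = 1 := by
    rw [hs.imp_of_ge (le_imp_imp' v y), hs.join, hs.imp_of_ge hyv]
    ring
  exact hs.eq_one (imp_anti (imp'_anti (imp_anti hxv y) y) v) h

/-- Prelinearity modulo the kernel of a Bosbach state. -/
theorem imp_imp'_imp_le (hs : IsRealBosbachState s) (x y : A) :
    s ((x ⇀ y) ⇝ (y ⇀ x)) ≤ s (y ⇀ x) := by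
  -- De Morgan: `n` is an upper bound of the negations, so its negation `m` acts as a meet of `x`
  -- and `y` modulo the kernel, where double negation is trivial.
  set n : A := ((x ⇀ 0) ⇝ (y ⇀ 0)) ⇀ (y ⇀ 0) with hn
  set m : A := n ⇝ 0 with hm
  have hdn : ∀ w : A, s (((w ⇀ 0) ⇝ 0) ⇀ w) = 1 := fun w => by
    rw [hs.imp_of_ge (le_imp_imp' w 0), hs.join,
      hs.imp_of_ge (BoundedPseudoBCKAlgebra.zero_le' w), hs.map_zero]
    ring
  have hmx : s (m ⇀ x) = 1 := hs.eq_one (imp_anti (imp'_anti (le_imp'_imp _ _) 0) x) (hdn x)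
  have hmy : s (m ⇀ y) = 1 :=
    hs.eq_one (imp_anti (imp'_anti (PseudoBCKAlgebra.le_imp _ _) 0) y) (hdn y)
  have h₁ : (y ⇀ x) ≤ (y ⇀ m) := by
    rw [hm, imp_imp'_comm]
    exact trans (imp_le y x 0) (le_imp_imp' _ _)
  have h₂ : s ((x ⇀ y) ⇝ (y ⇀ x)) ≤ s ((x ⇀ m) ⇝ (y ⇀ x)) := by
    apply hs.le_of_imp
    apply hs.eq_one (imp'_le (x ⇀ m) (x ⇀ y) (y ⇀ x))
    rw [← hs.imp_eq_imp']
    exact hs.eq_one (imp_le_imp_imp m y x) hmy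
  -- By exchange the left side is `y ⇀ ((x ⇀ m) ⇝ m)`, and this join equals `x` modulo the kernel.
  have h₃ : s ((x ⇀ m) ⇝ (y ⇀ m)) ≤ s (y ⇀ x) := by
    rw [← imp_imp'_comm]
    apply hs.le_of_imp
    apply hs.eq_one (imp_le_imp_imp ((x ⇀ m) ⇝ m) x y)
    rw [hs.imp_of_ge (le_imp_imp' x m), hs.join]
    have := hs.add_imp x m
    linarith
  exact h₂.trans ((hs.mono (imp'_mono_right h₁ _)).trans h₃)

/-- The two operators commute by exchange, and an outermost `⇀` may be replaced by `⇝` without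
changing the value. -/
theorem iterate_imp_iterate_imp' (hs : IsRealBosbachState s) (a x : A) (n m : ℕ) :
    s ((a ⇀ ·)^[n] ((a ⇝ ·)^[m] x)) = s ((a ⇝ ·)^[n + m] x) := by
  induction n generalizing m with
  | zero => simp
  | succ n ih =>
    have hc : Function.Commute (a ⇝ ·) (a ⇀ ·) := fun w => (imp_imp'_comm a a w).symm
    rw [Function.iterate_succ_apply', hs.imp_eq_imp']
    have := (hc.iterate_right n) ((a ⇝ ·)^[m] x)
    rw [this, ← Function.iterate_succ_apply' (a ⇝ ·) m x, ih]
    congr 2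
    omega

theorem iterate_imp (hs : IsRealBosbachState s) (a x : A) (n : ℕ) :
    s ((a ⇀ ·)^[n] x) = s ((a ⇝ ·)^[n] x) :=
  hs.iterate_imp_iterate_imp' a x n 0

theorem iterate_mono (hs : IsRealBosbachState s) (a : A) (h : s (x ⇀ y) = 1) (n : ℕ) :
    s ((a ⇝ ·)^[n] x) ≤ s ((a ⇝ ·)^[n] y) := by
  rw [← hs.iterate_imp, ← hs.iterate_imp]
  exact hs.le_of_imp (hs.eq_one (imp_le_iterate_imp a x y n) h)

/-! ### Localization of a Bosbach state at an element -/

/-- The pointwise supremum over `n` of the functions `x ↦ s (aⁿ → x)`. -/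
noncomputable def localization (s : A → ℝ) (a x : A) : ℝ := ⨆ n : ℕ, s ((a ⇝ ·)^[n] x)

theorem tendsto_localization (hs : IsRealBosbachState s) (a x : A) :
    Tendsto (fun n : ℕ => s ((a ⇝ ·)^[n] x)) atTop (𝓝 (localization s a x)) := by
  refine tendsto_atTop_ciSup (monotone_nat_of_le_succ fun n => ?_)
    ⟨1, by rintro _ ⟨n, rfl⟩; exact hs.le_one _⟩
  rw [Function.iterate_succ_apply']
  exact hs.mono (PseudoBCKAlgebra.le_imp' _ _)

theorem localization_dual (hs : IsRealBosbachState s) (a x : A) :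
    @localization A (BoundedPseudoBCKAlgebra.dual A) s a x = localization s a x :=
  iSup_congr fun n => hs.iterate_imp a x n

theorem le_localization (hs : IsRealBosbachState s) (a x : A) : s x ≤ localization s a x :=
  ge_of_tendsto' (hs.tendsto_localization a x) fun n => hs.mono (le_iterate_imp' a x n)

theorem localization_le_one (hs : IsRealBosbachState s) (a x : A) : localization s a x ≤ 1 :=
  le_of_tendsto' (hs.tendsto_localization a x) fun _ => hs.le_one _

theorem localization_mono (hs : IsRealBosbachState s) (a : A) (h : s (x ⇀ y) = 1) :
    localization s a x ≤ localization s a y :=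
  le_of_tendsto_of_tendsto' (hs.tendsto_localization a x) (hs.tendsto_localization a y)
    fun n => hs.iterate_mono a h n

theorem localization_imp_of_ge (hs : IsRealBosbachState s) (a : A) (h : y ≤ x) :
    localization s a (x ⇀ y) = 1 - localization s a x + localization s a y := by
  have hx := hs.tendsto_localization a x
  have hy := hs.tendsto_localization a y
  have hxy := hs.tendsto_localization a (x ⇀ y)
  apply _root_.le_antisymm
  · have hy2 : Tendsto (fun n : ℕ => s ((a ⇝ ·)^[n + n] y)) atTop (𝓝 (localization s a y)) :=
      hy.comp (tendsto_atTop_mono (fun n => Nat.le_add_left n n) tendsto_id)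
    have := le_of_tendsto_of_tendsto' (hx.add hxy) (hy2.const_add 1) fun n => ?_
    · linarith
    rw [← hs.iterate_imp_iterate_imp', ← hs.iterate_imp a x, iterate_imp'_imp]
    exact (add_le_add_right (hs.mono (imp_le_iterate_imp a _ _ n)) _).trans (hs.add_imp_le _ _)
  · refine le_of_tendsto_of_tendsto' ((hx.const_sub 1).add hy) hxy fun n => ?_
    rw [iterate_imp'_imp]
    have h₁ := hs.join_le (le_iterate_imp' a x n) (iterate_imp'_mono a h n)
    rw [hs.join] at h₁
    linarith

/-- The value at `x ⇀ y` is determined by those at `y` and at the join, and the join is symmetric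
modulo the kernel. -/
theorem localization_add_imp (hs : IsRealBosbachState s) (a x y : A) :
    localization s a x + localization s a (x ⇀ y) =
      localization s a y + localization s a (y ⇀ x) := by
  have key : ∀ x y : A, localization s a (x ⇀ y) =
      1 - localization s a ((x ⇀ y) ⇝ y) + localization s a y := fun x y => by
    rw [← hs.localization_imp_of_ge a (PseudoBCKAlgebra.le_imp' (x ⇀ y) y)]
    congr 1
    exact le_antisymm' _ _ (le_imp'_imp _ _) (imp_anti (le_imp_imp' _ _) _)
  rw [key x y, key y x, _root_.le_antisymm (hs.localization_mono a (hs.join_imp_join x y))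
    (hs.localization_mono a (hs.join_imp_join y x))]
  ring

theorem localization_add_imp' (hs : IsRealBosbachState s) (a x y : A) :
    localization s a x + localization s a (x ⇝ y) =
      localization s a y + localization s a (y ⇝ x) := by
  simp only [← hs.localization_dual]
  exact @localization_add_imp A (BoundedPseudoBCKAlgebra.dual A) s hs.dual a x y

theorem localization_one (hs : IsRealBosbachState s) (a : A) : localization s a 1 = 1 :=
  _root_.le_antisymm (hs.localization_le_one a 1) (hs.map_one ▸ hs.le_localization a 1)

theorem localization_self (hs : IsRealBosbachState s) (a : A) : localization s a a = 1 := by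
  refine tendsto_nhds_unique (hs.tendsto_localization a a)
    (tendsto_const_nhds.congr' ((eventually_ge_atTop 1).mono fun n hn => ?_))
  obtain ⟨k, rfl⟩ := Nat.exists_eq_add_of_le' hn
  simp only [Function.iterate_succ_apply, imp'_self]
  exact (hs.eq_one (le_iterate_imp' a 1 k) hs.map_one).symm

/-- The hypothesis makes `a ⇝ x` and `x` equal modulo the kernel, so iteration never raises the
value. -/
theorem localization_eq_self (hs : IsRealBosbachState s) (h : s (a ⇝ x) ≤ s x) :
    localization s a x = s x := by
  refine tendsto_nhds_unique (hs.tendsto_localization a x) (tendsto_const_nhds.congr fun n => ?_)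
  induction n with
  | zero => rfl
  | succ n ih =>
    refine _root_.le_antisymm (hs.mono (le_iterate_imp' a x _)) ?_
    rw [ih, Function.iterate_succ_apply]
    refine hs.iterate_mono a ?_ n
    have h₁ := PseudoBCKAlgebra.le_imp' a x
    rw [hs.imp_of_ge h₁]
    linarith [hs.mono h₁]

end IsRealBosbachState

/-- The set of Bosbach states, as real-valued functions. -/
def realBosbachStates (A : Type*) [BoundedPseudoBCKAlgebra A] : Set (A → ℝ) :=
  {s | IsRealBosbachState s}

/-! ### Extreme Bosbach states are state-morphisms -/

section Extreme

variable {A : Type*} [BoundedPseudoBCKAlgebra A]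

/-- A nonnegative function that vanishes at `1` and satisfies the Bosbach equations becomes the
complement of a Bosbach state after normalization. -/
theorem isRealBosbachState_one_sub_div {t : A → ℝ} (h0 : 0 < t 0) (h1 : t 1 = 0)
    (hn : ∀ x, 0 ≤ t x) (hi : ∀ x y : A, t x + t (x ⇀ y) = t y + t (y ⇀ x))
    (hi' : ∀ x y : A, t x + t (x ⇝ y) = t y + t (y ⇝ x)) :
    IsRealBosbachState fun x => 1 - t x / t 0 where
  nonneg x := by
    have h := hi x 0
    rw [(le_iff_imp 0 x).1 (BoundedPseudoBCKAlgebra.zero_le' x), h1] at h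
    have : t x / t 0 ≤ 1 := (div_le_one h0).2 (by linarith [hn (x ⇀ 0)])
    linarith
  le_one x := by linarith [div_nonneg (hn x) h0.le]
  add_imp x y := by
    have h := congrArg (· / t 0) (hi x y)
    simp only [add_div] at h
    linarith
  add_imp' x y := by
    have h := congrArg (· / t 0) (hi' x y)
    simp only [add_div] at h
    linarith
  map_zero := by rw [div_self h0.ne', sub_self]
  map_one := by rw [h1, zero_div, sub_zero]

theorem one_sub_localization_of_extreme {s : A → ℝ} (h : s ∈ (realBosbachStates A).extremePoints ℝ)
    (a x : A) : 1 - IsRealBosbachState.localization s a x =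
      (1 - IsRealBosbachState.localization s a 0) * (1 - s x) := by
  have hs : IsRealBosbachState s := h.1
  set r := IsRealBosbachState.localization s a with hr
  have hb0 : ∀ {t : A → ℝ}, t 0 = 0 → t 1 = 0 → (∀ x, 0 ≤ t x) →
      (∀ x y : A, t x + t (x ⇀ y) = t y + t (y ⇀ x)) → ∀ x, t x = 0 := by
    intro t h0 h1 hn hi x
    have h := hi x 0
    rw [(le_iff_imp 0 x).1 (BoundedPseudoBCKAlgebra.zero_le' x), h1, h0] at h
    linarith [hn x, hn (x ⇀ 0)]
  have ha := hs.localization_add_imp a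
  have ha' := hs.localization_add_imp' a
  have h1 := hs.localization_one a
  have hle := hs.localization_le_one a
  have hge := hs.le_localization a
  rw [← hr] at ha ha' h1 hle hge
  have hs0 := hs.map_zero
  have hs1 := hs.map_one
  have hc0 : 0 ≤ r 0 := hs0 ▸ hge 0
  -- The weights are `1 - r 0` and `r 0`. If one is zero, the corresponding summand vanishes
  -- identically by `hb0`; otherwise both summands can be normalized.
  rcases hc0.eq_or_lt with hc | hc
  · have := hb0 (t := fun x => r x - s x) (by simp [← hc, hs0]) (by simp [h1, hs1])
      (fun x => by linarith [hge x]) (fun x y => by linarith [ha x y, hs.add_imp x y]) x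
    rw [← hc]
    linarith
  rcases (hle 0).eq_or_lt with hc1 | hc1
  · have := hb0 (t := fun x => 1 - r x) (by simp [hc1]) (by simp [h1])
      (fun x => by linarith [hle x]) (fun x y => by linarith [ha x y]) x
    rw [this, hc1]
    ring
  have k₁ := isRealBosbachState_one_sub_div (t := fun x => 1 - r x) (by linarith)
    (by simp [h1]) (fun x => by linarith [hle x]) (fun x y => by linarith [ha x y])
    (fun x y => by linarith [ha' x y])
  have k₂ := isRealBosbachState_one_sub_div (t := fun x => r x - s x) (by linarith)
    (by simp [h1, hs1]) (fun x => by linarith [hge x])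
    (fun x y => by linarith [ha x y, hs.add_imp x y])
    (fun x y => by linarith [ha' x y, hs.add_imp' x y])
  have hseg := h.2 k₁ k₂ ⟨1 - r 0, r 0, by linarith, hc, by ring, by
    funext z
    have hne : (1 - r 0) ≠ 0 := by linarith
    have hne' : r 0 ≠ 0 := hc.ne'
    simp only [Pi.add_apply, Pi.smul_apply, smul_eq_mul, hs0, sub_zero]
    field_simp
    ring⟩
  have h' : 1 - (1 - r x) / (1 - r 0) = s x := congrFun hseg x
  have hne : (1 - r 0) ≠ 0 := by linarith
  rw [← h']
  field_simp
  ring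

theorem imp_eq_one_or_of_extreme {s : A → ℝ} (h : s ∈ (realBosbachStates A).extremePoints ℝ)
    (x y : A) : s (x ⇀ y) = 1 ∨ s (y ⇀ x) = 1 := by
  have hs : IsRealBosbachState s := h.1
  have hp := one_sub_localization_of_extreme h (x ⇀ y) (x ⇀ y)
  have hq := one_sub_localization_of_extreme h (x ⇀ y) (y ⇀ x)
  rw [hs.localization_self, sub_self] at hp
  rw [hs.localization_eq_self (hs.imp_imp'_imp_le x y)] at hq
  rcases mul_eq_zero.1 hp.symm with hc | hc
  · rw [hc, zero_mul] at hq
    right; linarith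
  · left; linarith

theorem imp_of_extreme {s : A → ℝ} (h : s ∈ (realBosbachStates A).extremePoints ℝ)
    (x y : A) : s (x ⇀ y) = min (1 - s x + s y) 1 := by
  have hs : IsRealBosbachState s := h.1
  have h₁ := hs.add_imp x y
  rcases imp_eq_one_or_of_extreme h x y with h' | h'
  · rw [h', min_eq_right]
    linarith [hs.le_one (y ⇀ x)]
  · rw [min_eq_left] <;> linarith [hs.le_one (x ⇀ y)]

theorem isStateMorphism_of_extreme {m : A → unitInterval}
    (h : (fun x => (m x : ℝ)) ∈ (realBosbachStates A).extremePoints ℝ) : IsStateMorphism m where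
  map_zero := Subtype.ext h.1.map_zero
  map_imp x y := Subtype.ext (imp_of_extreme h x y)
  map_imp' x y := Subtype.ext ((h.1.imp_eq_imp' x y).symm.trans (imp_of_extreme h x y))

theorem isCompact_realBosbachStates : IsCompact (realBosbachStates A) := by
  have hK : IsCompact (Set.univ.pi fun _ : A => Set.Icc (0 : ℝ) 1) :=
    isCompact_univ_pi fun _ => isCompact_Icc
  have hC : IsClosed {s : A → ℝ | (∀ x y : A, s x + s (x ⇀ y) = s y + s (y ⇀ x)) ∧
      (∀ x y : A, s x + s (x ⇝ y) = s y + s (y ⇝ x)) ∧ s 0 = 0 ∧ s 1 = 1} := by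
    simp only [Set.ofPred_and, Set.ofPred_forall]
    refine IsClosed.inter (isClosed_iInter fun x => isClosed_iInter fun y => ?_)
      (IsClosed.inter (isClosed_iInter fun x => isClosed_iInter fun y => ?_)
        (IsClosed.inter ?_ ?_)) <;>
    exact isClosed_eq (by fun_prop) (by fun_prop)
  convert hK.inter_right hC using 1
  ext s
  constructor
  · intro h
    exact ⟨fun x _ => ⟨h.nonneg x, h.le_one x⟩, h.add_imp, h.add_imp', h.map_zero, h.map_one⟩
  · rintro ⟨h, h₁, h₂, h₃, h₄⟩
    exact ⟨fun x => (h x trivial).1, fun x => (h x trivial).2, h₁, h₂, h₃, h₄⟩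

end Extreme

/-! ### Minimization at extreme points, and coherence -/

/-- A continuous linear functional attains its minimum over a nonempty compact set at an extreme
point. -/
theorem IsCompact.exists_extremePoint_forall_le {E : Type*} [AddCommGroup E] [Module ℝ E]
    [TopologicalSpace E] [T2Space E] [IsTopologicalAddGroup E] [ContinuousSMul ℝ E]
    [LocallyConvexSpace ℝ E] {K : Set E} (hK : IsCompact K) (hne : K.Nonempty) (l : E →L[ℝ] ℝ) :
    ∃ x ∈ K.extremePoints ℝ, ∀ y ∈ K, l x ≤ l y := by
  obtain ⟨x₀, hx₀, hmin⟩ := hK.exists_isMinOn hne l.continuous.continuousOn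
  -- Exposed faces are sets of maximizers, hence the sign.
  have hF : IsExposed ℝ K ((-l).toExposed K) := ContinuousLinearMap.toExposed.isExposed
  obtain ⟨x, hx⟩ := (hF.isCompact hK).extremePoints_nonempty
    ⟨x₀, hx₀, fun y hy => neg_le_neg (hmin hy)⟩
  exact ⟨x, hF.isExtreme.extremePoints_subset_extremePoints hx,
    fun y hy => neg_le_neg_iff.1 (hx.1.2 y hy)⟩

/-- A de Finetti map satisfies every affine relation that all members of `W` satisfy. -/
theorem linearCombination_eq_of_mem_deFinettiMaps {A : Type*} {W : Set (A → unitInterval)}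
    {β : A → unitInterval} (hβ : β ∈ deFinettiMaps W) (σ : A →₀ ℝ) (c : ℝ)
    (h : ∀ V ∈ W, Finsupp.linearCombination ℝ (fun a => (V a : ℝ)) σ = c) :
    Finsupp.linearCombination ℝ (fun a => (β a : ℝ)) σ = c := by
  have key : ∀ V : A → unitInterval, ∑ a : σ.support, σ a * ((β a : ℝ) - (V a : ℝ)) =
      Finsupp.linearCombination ℝ (fun a => (β a : ℝ)) σ -
        Finsupp.linearCombination ℝ (fun a => (V a : ℝ)) σ := fun V => by
    rw [Finset.sum_coe_sort σ.support fun a => σ a * ((β a : ℝ) - (V a : ℝ))]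
    simp [Finsupp.linearCombination_apply, Finsupp.sum, mul_sub]
  obtain ⟨V, hV, h₁⟩ := hβ σ.support fun a => σ a
  obtain ⟨V', hV', h₂⟩ := hβ σ.support fun a => -σ a
  simp only [neg_mul, Finset.sum_neg_distrib] at h₂
  rw [key, h V hV] at h₁
  rw [key, h V' hV'] at h₂
  linarith

theorem add_min_one_sub_add (u v : ℝ) :
    u + min (1 - u + v) 1 = v + min (1 - v + u) 1 := by
  rcases le_total u v with h | h
  · rw [min_eq_right (by linarith), min_eq_left (by linarith)]; ring
  · rw [min_eq_left (by linarith), min_eq_right (by linarith)]; ring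

theorem IsStateMorphism.map_one {A : Type*} [BoundedPseudoBCKAlgebra A] {m : A → unitInterval}
    (hm : IsStateMorphism m) : m 1 = 1 := by
  rw [← imp_self (0 : A), hm.map_imp, hm.map_zero]
  ext
  simp [lukasiewiczImp]

theorem isBosbachState_of_mem_deFinettiMaps {A : Type*} [BoundedPseudoBCKAlgebra A]
    {β : A → unitInterval} (hβ : β ∈ deFinettiMaps (stateMorphisms A)) : IsBosbachState β := by
  have key : ∀ x y p q : A, (∀ V ∈ stateMorphisms A, (V x : ℝ) + V p = V y + V q) →
      (β x : ℝ) + β p = β y + β q := fun x y p q h => by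
    have := linearCombination_eq_of_mem_deFinettiMaps hβ
      (.single x 1 + .single p 1 - .single y 1 - .single q 1) 0 fun V hV => by
        simp only [map_sub, map_add, Finsupp.linearCombination_single, one_smul]
        linarith [h V hV]
    simp only [map_sub, map_add, Finsupp.linearCombination_single, one_smul] at this
    linarith
  have hconst : ∀ (x : A) (c : ℝ), (∀ V ∈ stateMorphisms A, (V x : ℝ) = c) → (β x : ℝ) = c :=
    fun x c h => by
      have := linearCombination_eq_of_mem_deFinettiMaps hβ (.single x 1) c fun V hV => by
        simpa using h V hV
      simpa using this
  refine ⟨fun x y => key _ _ _ _ fun V hV => ?_, fun x y => key _ _ _ _ fun V hV => ?_,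
    Subtype.ext (hconst 0 0 fun V hV => congrArg Subtype.val hV.map_zero),
    Subtype.ext (hconst 1 1 fun V hV => congrArg Subtype.val hV.map_one)⟩
  · rw [hV.map_imp, hV.map_imp]
    exact add_min_one_sub_add _ _
  · rw [hV.map_imp', hV.map_imp']
    exact add_min_one_sub_add _ _

theorem mem_deFinettiMaps_of_isBosbachState {A : Type*} [BoundedPseudoBCKAlgebra A]
    {s : A → unitInterval} (hs : IsBosbachState s) : s ∈ deFinettiMaps (stateMorphisms A) := by
  intro A' σ
  have hsr : (fun x => (s x : ℝ)) ∈ realBosbachStates A :=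
    ⟨fun x => (s x).2.1, fun x => (s x).2.2, hs.add_imp, hs.add_imp',
      congrArg Subtype.val hs.map_zero, congrArg Subtype.val hs.map_one⟩
  let l : (A → ℝ) →L[ℝ] ℝ :=
    ∑ a : A', σ a • ContinuousLinearMap.proj (R := ℝ) (φ := fun _ : A => ℝ) (a : A)
  have hl : ∀ f : A → ℝ, l f = ∑ a : A', σ a * f a := fun f => by
    simp [l]
  obtain ⟨m, hm, hmin⟩ := isCompact_realBosbachStates.exists_extremePoint_forall_le ⟨_, hsr⟩ l
  refine ⟨fun x => ⟨m x, hm.1.nonneg x, hm.1.le_one x⟩, isStateMorphism_of_extreme hm, ?_⟩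
  have := hmin _ hsr
  rw [hl, hl] at this
  simpa [mul_sub] using this

theorem mainTheorem9 (A : Type*) [BoundedPseudoBCKAlgebra A]
    (hW : (stateMorphisms A).Nonempty) :
    deFinettiMaps (stateMorphisms A) = bosbachStates A := by
  ext β
  exact ⟨isBosbachState_of_mem_deFinettiMaps, mem_deFinettiMaps_of_isBosbachState⟩
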